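/- Let $\mathcal A=\{H_1,\dots,H_l\}$ be an arrangement of pairwise distinct hyperplanes in $\mathbb{CP}^n$; identify projective subspaces with their cones, which are linear subspaces of $\mathbb C^{n+1}$, so that a hyperplane has linear dimension $n$ and the zero subspace represents $\emptyset$. Let $E$ be the exterior algebra of $\mathbb C^l$ with canonical generators $x_1,\dots,x_l$, let $K\subseteq E$ be the two-sided ideal generated by the elements $$\partial(x_{i_1}\wedge\cdots\wedge x_{i_m})=\sum_{j=1}^m(-1)^j\,x_{i_1}\wedge\cdots\wedge x_{i_{j-1}}\wedge x_{i_{j+1}}\wedge\cdots\wedge x_{i_m}$$ for distinct $i_1,\dots,i_m$ such that $H_{i_1}\cap\cdots\cap H_{i_m}$ is nonempty and of codimension less than $m$, and by the monomials $x_{i_1}\wedge\cdots\wedge x_{i_m}$ for distinct $i_1,\dots,i_m$ with $H_{i_1}\cap\cdots\cap H_{i_m}=\emptyset$. Let $A=E/K$ be the Orlik–Solomon algebra and $A^1\subseteq A$ its degree-one part, spanned by $x_1,\dots,x_l$. For an integer $k\ge 0$, a linear subspace $V\subseteq A^1$ is called $k$-isotropic if the product of any $k$ vectors of $V$ is zero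 in $A$. Let $V\subseteq A^1$ be a linear subspace and let $M$ be an $r\times l$ complex matrix whose rows are the coefficients with respect to $x_1,\dots,x_l$ of a generating system of $V$. Let $v_1,\dots,v_l\in\mathbb C^r$ be the columns of $M$, and decorate every flat $S$ (nonempty intersection of hyperplanes of $\mathcal A$) with the vector $v_S=\sum_{H_i\supseteq S}v_i$. Then $V$ is $k$-isotropic if and only if for every truncated flag of flats $S_k\supset\cdots\supset S_1$ whose linear dimensions (dimensions of the cones in $\mathbb C^{n+1}$) are $\dim S_i=i+n-k$, the vectors $v_{S_k},\dots,v_{S_1}$ span a space of dimension less than $k$. -/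

import Mathlib

/-- An arrangement of `l` pairwise distinct hyperplanes `H_1, …, H_l` in the projective space
`ℂP^n`. A projective subspace is given by its cone, a linear subspace of `ℂ^(n+1)`; so a
hyperplane is a linear subspace of dimension `n`, and the zero subspace is the empty set. -/
structure ProjArrangement (n l : ℕ) where
  hyp : Fin l → Submodule ℂ (Fin (n + 1) → ℂ)
  finrank_hyp : ∀ i, Module.finrank ℂ (hyp i) = n
  hyp_injective : Function.Injective hyp

namespace ProjArrangement

/-- The exterior algebra `E` of `ℂ^l`. -/
abbrev Ext (l : ℕ) : Type := ExteriorAlgebra ℂ (Fin l → ℂ)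

/-- The monomial `x_{t 1} ∧ ⋯ ∧ x_{t m}` in the canonical generators of `E`. -/
noncomputable def monomial {l m : ℕ} (t : Fin m → Fin l) : Ext l :=
  ExteriorAlgebra.ιMulti ℂ m (fun j => (Pi.single (t j) 1 : Fin l → ℂ))

/-- `∂(x_{t 1} ∧ ⋯ ∧ x_{t m}) = ∑_j (-1)^j x_{t 1} ∧ ⋯ (omit the factor j) ⋯ ∧ x_{t m}` for a tuple
of `m + 1` indices; the position `j` counts from `0` here and from `1` in the formula. -/
noncomputable def boundary {l m : ℕ} (t : Fin (m + 1) → Fin l) : Ext l :=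
  ∑ j : Fin (m + 1), (-1 : ℂ) ^ ((j : ℕ) + 1) • monomial (t ∘ j.succAbove)

variable {n l : ℕ} (𝒜 : ProjArrangement n l)

/-- The intersection of a tuple of hyperplanes (for the empty tuple, the whole space). -/
def inter {m : ℕ} (t : Fin m → Fin l) : Submodule ℂ (Fin (n + 1) → ℂ) :=
  ⨅ j, 𝒜.hyp (t j)

/-- The hyperplanes of the tuple have a common point, and their intersection has codimension
smaller than the number of hyperplanes. -/
def NonGeneric {m : ℕ} (t : Fin m → Fin l) : Prop :=
  𝒜.inter t ≠ ⊥ ∧ n + 1 < Module.finrank ℂ (𝒜.inter t) + m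

/-- The ideal `K` generated by `∂(x_{t 1} ∧ ⋯ ∧ x_{t m})` for the tuples of distinct hyperplanes
that intersect non-generically and by the monomials `x_{t 1} ∧ ⋯ ∧ x_{t m}` for the tuples of
distinct hyperplanes without common point in `ℂP^n`. -/
def osIdeal : TwoSidedIdeal (Ext l) :=
  TwoSidedIdeal.span
    ({a | ∃ (m : ℕ) (t : Fin (m + 1) → Fin l),
        Function.Injective t ∧ 𝒜.NonGeneric t ∧ a = boundary t} ∪
      {a | ∃ (m : ℕ) (t : Fin m → Fin l),
        Function.Injective t ∧ 𝒜.inter t = ⊥ ∧ a = monomial t})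

/-- The Orlik-Solomon algebra `A = E / K`. -/
abbrev OS : Type := 𝒜.osIdeal.ringCon.Quotient

/-- The canonical generator `x_i` of the Orlik-Solomon algebra. -/
def gen (i : Fin l) : 𝒜.OS :=
  ((ExteriorAlgebra.ι ℂ (Pi.single i 1 : Fin l → ℂ) : Ext l) : 𝒜.osIdeal.ringCon.Quotient)

/-- The homogeneous part `A^1` of degree one. -/
def degreeOne : Submodule ℂ 𝒜.OS := Submodule.span ℂ (Set.range 𝒜.gen)

/-- `V` is `k`-isotropic: the product of any `k` vectors of `V` vanishes. -/
def IsIsotropic (k : ℕ) (V : Submodule ℂ 𝒜.OS) : Prop :=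
  ∀ w : Fin k → 𝒜.OS, (∀ i, w i ∈ V) → (List.ofFn w).prod = 0

/-- `S` is a flat, that is, a (nonempty) intersection of hyperplanes of the arrangement. -/
def IsFlat (S : Submodule ℂ (Fin (n + 1) → ℂ)) : Prop :=
  S ≠ ⊥ ∧ ∃ T : Set (Fin l), S = ⨅ i ∈ T, 𝒜.hyp i

/-- `S_k ⊃ ⋯ ⊃ S_1` is a truncated flag of length `k` of the intersection lattice, where
`dim S_i = i + n - k` as linear subspaces of `ℂ^(n+1)`. The subspace `S_i` of the usual numbering
is `S (i - 1)`. -/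
structure IsTruncatedFlag {k : ℕ} (S : Fin k → Submodule ℂ (Fin (n + 1) → ℂ)) : Prop where
  isFlat : ∀ i, 𝒜.IsFlat (S i)
  strictMono : StrictMono S
  finrank_add : ∀ i : Fin k, Module.finrank ℂ (S i) + k = ((i : ℕ) + 1) + n

open Classical in
/-- The decoration `v_S`, the sum of the columns `v_i` of `M` over all `i` with `H_i ⊇ S`. -/
noncomputable def decoration {r : ℕ} (M : Matrix (Fin r) (Fin l) ℂ)
    (S : Submodule ℂ (Fin (n + 1) → ℂ)) : Fin r → ℂ :=
  ∑ i with S ≤ 𝒜.hyp i, M.col i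

end ProjArrangement

/-!
A chain of subspaces `S_1 ⊂ ⋯ ⊂ S_k` defines a linear map `ℂ^l → ℂ^k` that sends `x_i` to the
indicator vector of `{p | S_p ⊆ H_i}`. This vector only depends on the number of members of the
chain contained in `H_i`, and hyperplanes for which these numbers are pairwise distinct are
independent; hence two of the generators of a non-generic tuple have the same image, and the
induced homomorphism of exterior algebras kills `K` as soon as the `S_p` are nonzero. Followed by
the determinant in degree `k` it becomes a linear functional on `A^k`, the residue along the
chain. On a product of `k` vectors of `V` the residue is a determinant, and all these determinants
vanish if and only if the vectors `v_{S_p}` are linearly dependent, because row rank equals column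
rank.

It remains to see that the residues along truncated flags separate the points of `A^k`. By
straightening, `A^k` is spanned by the monomials without broken circuits. Such a monomial has a
truncated flag of its own, formed by the intersections of its tails, and the matrix of residues of
these monomials along these flags is unitriangular for the order by the sum of the indices.
-/

section General

open Module Finset

/-- The number of members of a finite chain that lie below `x`. It measures how far up the chain
`x` dominates, since for a monotone chain these members form an initial segment. -/
noncomputable def chainDepth {α : Type*} [LE α] {k : ℕ} (S : Fin k → α) (x : α) : ℕ :=
  open Classical in #{p | S p ≤ x}

theorem chainDepth_le {α : Type*} [LE α] {k : ℕ} (S : Fin k → α) (x : α) : chainDepth S x ≤ k :=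
  (card_le_univ _).trans (Fintype.card_fin k).le

theorem lt_chainDepth_iff {α : Type*} [Preorder α] {k : ℕ} {S : Fin k → α} (hS : Monotone S)
    {x : α} {p : Fin k} : p < chainDepth S x ↔ S p ≤ x := by
  classical
  exact Tuple.lt_card_le_iff_apply_le_of_monotone hS

section Codimension

variable {K V ι : Type*} [DivisionRing K] [AddCommGroup V] [Module K V] [FiniteDimensional K V]
  {H : ι → Submodule K V} {T : Finset ι}

theorem finrank_le_finrank_inf_add_one {P : Submodule K V} (hP : finrank K V ≤ finrank K P + 1)
    (Q : Submodule K V) : finrank K Q ≤ finrank K (P ⊓ Q : Submodule K V) + 1 := by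
  have h_sum := Submodule.finrank_sup_add_finrank_inf_eq P Q
  have h_sup := Submodule.finrank_le (P ⊔ Q)
  omega

theorem finrank_le_finrank_biInf_add_card (hH : ∀ i ∈ T, finrank K V ≤ finrank K (H i) + 1) :
    finrank K V ≤ finrank K (⨅ i ∈ T, H i : Submodule K V) + #T := by
  classical
  induction T using Finset.induction_on with
  | empty =>
    have hempty : ⨅ i ∈ (∅ : Finset ι), H i = ⊤ := by simp
    rw [hempty, finrank_top, card_empty, add_zero]
  | insert a T ha ih =>
    have h_rest := ih fun i hi => hH i (mem_insert_of_mem hi)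
    have h_step := finrank_le_finrank_inf_add_one (hH a (mem_insert_self a T)) (⨅ i ∈ T, H i)
    rw [card_insert_of_notMem ha, Finset.iInf_insert]
    omega

/-- Intersecting in the order of decreasing depth, each subspace cuts down the dimension because
it misses a member of the chain contained in all the previous ones. -/
theorem finrank_biInf_add_card_le {k : ℕ} {S : Fin k → Submodule K V} (hS : Monotone S)
    (hH : ∀ i ∈ T, H i ≠ ⊤) (hinj : Set.InjOn (fun i => chainDepth S (H i)) T) :
    finrank K (⨅ i ∈ T, H i : Submodule K V) + #T ≤ finrank K V := by
  classical
  induction T using Finset.induction_on_min_value (fun i => chainDepth S (H i)) with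
  | empty =>
    have hempty : ⨅ i ∈ (∅ : Finset ι), H i = ⊤ := by simp
    rw [hempty, finrank_top, card_empty, add_zero]
  | insert a T ha hmin ih =>
    have h_rest := ih (fun i hi => hH i (mem_insert_of_mem hi)) (hinj.mono (by simp))
    have hlt : ∀ i ∈ T, chainDepth S (H a) < chainDepth S (H i) := fun i hi =>
      (hmin i hi).lt_of_ne fun h =>
        ha (hinj (mem_insert_self a T) (mem_insert_of_mem hi) h ▸ hi)
    have h_not_le : ¬ ⨅ i ∈ T, H i ≤ H a := by
      intro hle
      rcases T.eq_empty_or_nonempty with rfl | ⟨b, hb⟩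
      · exact hH a (mem_insert_self a ∅) (top_le_iff.1 (by simpa using hle))
      · let p : Fin k := ⟨chainDepth S (H a), (hlt b hb).trans_le (chainDepth_le S (H b))⟩
        have hp : S p ≤ ⨅ i ∈ T, H i :=
          le_iInf₂ fun i hi => (lt_chainDepth_iff hS).1 (hlt i hi)
        exact lt_irrefl _ ((lt_chainDepth_iff hS (p := p)).2 (hp.trans hle))
    have h_step := Submodule.finrank_lt_finrank_of_lt (inf_lt_right.2 h_not_le)
    rw [card_insert_of_notMem ha, Finset.iInf_insert]
    omega

end Codimension

theorem forall_det_eq_zero_iff_ne_top {K m : Type*} [Field K] [Fintype m] [DecidableEq m]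
    {W : Submodule K (m → K)} :
    (∀ A : Matrix m m K, (∀ j, A.row j ∈ W) → A.det = 0) ↔ W ≠ ⊤ := by
  constructor
  · rintro h rfl
    simpa using h 1 fun _ => Submodule.mem_top
  · intro hW A hA
    by_contra hdet
    have hrows := Matrix.linearIndependent_rows_of_det_ne_zero hdet
    have hspan := hrows.span_eq_top_of_card_eq_finrank' (finrank_fintype_fun_eq_card K).symm
    exact hW (top_le_iff.1 (hspan ▸ Submodule.span_le.2 (Set.range_subset_iff.2 hA)))

theorem span_range_col_ne_top_iff {K m n : Type*} [Field K] [Fintype m] [Finite n]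
    (A : Matrix m n K) :
    Submodule.span K (Set.range A.col) ≠ ⊤ ↔
      finrank K (Submodule.span K (Set.range A.row)) < Fintype.card m := by
  have := Fintype.ofFinite n
  rw [← A.rank_eq_finrank_span_row, A.rank_eq_finrank_span_cols, ← finrank_fintype_fun_eq_card K]
  refine ⟨Submodule.finrank_lt, ?_⟩
  rintro h htop
  rw [htop, finrank_top] at h
  exact lt_irrefl _ h

theorem sum_neg_one_pow_smul_map_removeNth_eq_zero {R M N : Type*} [CommRing R] [AddCommGroup M]
    [Module R M] [AddCommGroup N] [Module R N] {m : ℕ} (f : M [⋀^Fin m]→ₗ[R] N)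
    {v : Fin (m + 1) → M} {a b : Fin (m + 1)} (hv : v a = v b) (hab : a ≠ b) :
    ∑ j : Fin (m + 1), (-1 : ℤ) ^ (j : ℕ) • f (j.removeNth v) = 0 := by
  rw [Fintype.sum_eq_add a b hab]
  · exact f.neg_one_pow_smul_map_removeNth_add_eq_zero_of_eq hv hab
  · rintro j ⟨hja, hjb⟩
    obtain ⟨a', rfl⟩ := Fin.exists_succAbove_eq hja.symm
    obtain ⟨b', rfl⟩ := Fin.exists_succAbove_eq hjb.symm
    rw [f.map_eq_zero_of_eq (j.removeNth v) hv (ne_of_apply_ne _ hab), smul_zero]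

end General

namespace ProjArrangement

open ExteriorAlgebra Module

variable {n l k : ℕ}

/-! ### Monomials and the quotient map -/

theorem monomial_mul_monomial {p q : ℕ} (a : Fin p → Fin l) (b : Fin q → Fin l) :
    monomial a * monomial b = monomial (Fin.append a b) := by
  rw [monomial, monomial, ιMulti_mul_ιMulti, monomial]
  congr 1
  ext j : 1
  refine Fin.addCases (fun i => ?_) (fun i => ?_) j <;> simp

theorem monomial_mul_boundary {p m : ℕ} (a : Fin p → Fin l) (c : Fin (m + 1) → Fin l) :
    monomial a * boundary c =
      ∑ j : Fin (m + 1), (-1 : ℂ) ^ ((j : ℕ) + 1) • monomial (Fin.append a (c ∘ j.succAbove)) := by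
  simp only [boundary, Finset.mul_sum, mul_smul_comm, monomial_mul_monomial]

theorem monomial_eq_zero_of_not_injective {t : Fin k → Fin l} (ht : ¬ Function.Injective t) :
    monomial t = 0 :=
  ιMulti_eq_zero_of_not_inj fun h => ht fun a b hab => h (by simp [hab])

theorem monomial_comp_perm (t : Fin k → Fin l) (σ : Equiv.Perm (Fin k)) :
    monomial (t ∘ σ) = Equiv.Perm.sign σ • monomial t :=
  (ιMulti ℂ k).map_perm (fun j => (Pi.single (t j) 1 : Fin l → ℂ)) σ

theorem span_range_monomial :
    Submodule.span ℂ (Set.range (monomial : (Fin k → Fin l) → Ext l)) =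
      ⋀[ℂ]^k (Fin l → ℂ) := by
  rw [← exteriorPower.ιMulti_span_fixedDegree_of_span_eq_top ℂ k _
    (Pi.basisFun ℂ (Fin l)).span_eq]
  congr 1
  ext x
  constructor
  · rintro ⟨t, rfl⟩
    exact ⟨_, Set.range_subset_iff.2 fun j => ⟨t j, Pi.basisFun_apply ℂ _ _⟩, rfl⟩
  · rintro ⟨v, hv, rfl⟩
    obtain ⟨t, rfl⟩ := Set.range_subset_range_iff_exists_comp.1 hv
    exact ⟨t, congrArg _ (funext fun j => (Pi.basisFun_apply ℂ _ _).symm)⟩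

variable (𝒜 : ProjArrangement n l)

/-- The projection from the exterior algebra onto the Orlik-Solomon algebra. -/
noncomputable def toOS : Ext l →ₐ[ℂ] 𝒜.OS := RingCon.mkₐ ℂ 𝒜.osIdeal.ringCon

theorem toOS_eq_toOS_iff {x y : Ext l} : 𝒜.toOS x = 𝒜.toOS y ↔ x - y ∈ 𝒜.osIdeal := by
  rw [← TwoSidedIdeal.rel_iff]
  exact RingCon.eq _

theorem toOS_eq_zero_iff {x : Ext l} : 𝒜.toOS x = 0 ↔ x ∈ 𝒜.osIdeal := by
  rw [← map_zero 𝒜.toOS, toOS_eq_toOS_iff, sub_zero]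

theorem toOS_ι (w : Fin l → ℂ) : 𝒜.toOS (ι ℂ w) = ∑ i, w i • 𝒜.gen i := by
  conv_lhs => rw [pi_eq_sum_univ' w]
  simp only [map_sum, map_smul]
  rfl

theorem toOS_ιMulti (w : Fin k → Fin l → ℂ) :
    𝒜.toOS (ιMulti ℂ k w) = (List.ofFn fun j => 𝒜.toOS (ι ℂ (w j))).prod := by
  rw [ιMulti_apply, map_list_prod, List.map_ofFn]
  rfl

theorem isIsotropic_map_iff (R : Submodule ℂ (Fin l → ℂ)) :
    𝒜.IsIsotropic k (R.map (𝒜.toOS.toLinearMap ∘ₗ ι ℂ)) ↔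
      ∀ w : Fin k → Fin l → ℂ, (∀ j, w j ∈ R) → 𝒜.toOS (ιMulti ℂ k w) = 0 := by
  constructor
  · intro h w hw
    rw [toOS_ιMulti]
    exact h _ fun j => Submodule.mem_map_of_mem (hw j)
  · intro h w hw
    choose u hu huw using hw
    obtain rfl : (fun j => 𝒜.toOS (ι ℂ (u j))) = w := funext huw
    rw [← toOS_ιMulti]
    exact h u hu

/-! ### Intersections of hyperplanes -/

theorem finrank_space_le_finrank_hyp_add_one (i : Fin l) :
    finrank ℂ (Fin (n + 1) → ℂ) ≤ finrank ℂ (𝒜.hyp i) + 1 := by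
  rw [finrank_fin_fun, 𝒜.finrank_hyp]

theorem hyp_ne_top (i : Fin l) : 𝒜.hyp i ≠ ⊤ := fun h => by
  have := 𝒜.finrank_hyp i
  rw [h, finrank_top, finrank_fin_fun] at this
  omega

theorem inter_eq_biInf_image (t : Fin k → Fin l) :
    𝒜.inter t = ⨅ i ∈ Finset.univ.image t, 𝒜.hyp i := by
  rw [Finset.iInf_finset_image]
  simp [inter]

theorem le_finrank_inter_add (t : Fin k → Fin l) : n + 1 ≤ finrank ℂ (𝒜.inter t) + k := by
  have h_codim := finrank_le_finrank_biInf_add_card (T := Finset.univ.image t)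
    fun i _ => 𝒜.finrank_space_le_finrank_hyp_add_one i
  have h_card : (Finset.univ.image t).card ≤ k := Finset.card_image_le.trans (by simp)
  rw [← inter_eq_biInf_image, finrank_fin_fun] at h_codim
  omega

theorem inter_cons (i : Fin l) (b : Fin k → Fin l) :
    𝒜.inter (Fin.cons i b : Fin (k + 1) → Fin l) = 𝒜.hyp i ⊓ 𝒜.inter b := by
  refine le_antisymm (le_inf (iInf_le _ 0) (le_iInf fun j => iInf_le _ j.succ))
    (le_iInf fun j => ?_)
  cases j using Fin.cases with
  | zero => exact inf_le_left
  | succ j => exact inf_le_right.trans (iInf_le _ j)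

theorem nonGeneric_cons {i : Fin l} {b : Fin k → Fin l} (hbot : 𝒜.inter b ≠ ⊥)
    (hle : 𝒜.inter b ≤ 𝒜.hyp i) : 𝒜.NonGeneric (Fin.cons i b : Fin (k + 1) → Fin l) := by
  have h_codim := 𝒜.le_finrank_inter_add b
  rw [NonGeneric, inter_cons, inf_eq_right.2 hle]
  exact ⟨hbot, by omega⟩

theorem NonGeneric.exists_chainDepth_eq {𝒜 : ProjArrangement n l} {m : ℕ} {t : Fin m → Fin l}
    (h : 𝒜.NonGeneric t) (ht : Function.Injective t)
    {S : Fin k → Submodule ℂ (Fin (n + 1) → ℂ)} (hS : Monotone S) :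
    ∃ a b, a ≠ b ∧ chainDepth S (𝒜.hyp (t a)) = chainDepth S (𝒜.hyp (t b)) := by
  by_contra! hne
  have hinj : Set.InjOn (fun i => chainDepth S (𝒜.hyp i)) (Finset.univ.image t) := by
    rw [Finset.coe_image, Finset.coe_univ, Set.image_univ]
    rintro _ ⟨a, rfl⟩ _ ⟨b, rfl⟩ hab
    by_contra htab
    exact hne a b (ne_of_apply_ne t htab) hab
  have h_codim := finrank_biInf_add_card_le hS (fun i _ => 𝒜.hyp_ne_top i) hinj
  rw [← inter_eq_biInf_image, Finset.card_image_of_injective _ ht, Finset.card_fin,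
    finrank_fin_fun] at h_codim
  exact h.2.not_ge h_codim

/-! ### The residue along a chain of subspaces -/

section Residue

variable (S : Fin k → Submodule ℂ (Fin (n + 1) → ℂ))

open Classical in
/-- The linear map which sums, for each member of a chain, the coefficients of the hyperplanes
containing that member. It takes the rows of a matrix to the coordinates of the decorations. -/
noncomputable def flagMap : (Fin l → ℂ) →ₗ[ℂ] (Fin k → ℂ) :=
  LinearMap.pi fun p => ∑ i with S p ≤ 𝒜.hyp i, LinearMap.proj i

open Classical in
theorem flagMap_single (i : Fin l) :
    𝒜.flagMap S (Pi.single i 1) = fun p => if S p ≤ 𝒜.hyp i then 1 else 0 := by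
  ext p
  simp [flagMap]

theorem flagMap_row {r : ℕ} (M : Matrix (Fin r) (Fin l) ℂ) (j : Fin r) :
    𝒜.flagMap S (M.row j) = fun p => 𝒜.decoration M (S p) j := by
  ext p
  simp [flagMap, decoration]

/-- The homomorphism of exterior algebras induced by `flagMap`. -/
noncomputable def flagHom : Ext l →ₐ[ℂ] Ext k := ExteriorAlgebra.map (𝒜.flagMap S)

/-- The residue along a chain of `k` subspaces: the linear functional that applies `flagMap` to
each factor of a `k`-fold product and takes the determinant. It is `0` in all other degrees. -/
noncomputable def residue : Ext l →ₗ[ℂ] ℂ :=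
  liftAlternating (Function.update 0 k Matrix.detRowAlternating) ∘ₗ (𝒜.flagHom S).toLinearMap

theorem residue_ιMulti (w : Fin k → Fin l → ℂ) :
    𝒜.residue S (ιMulti ℂ k w) = Matrix.det (Matrix.of fun j => 𝒜.flagMap S (w j)) := by
  rw [residue, LinearMap.comp_apply, AlgHom.toLinearMap_apply, flagHom, map_apply_ιMulti,
    liftAlternating_apply_ιMulti, Function.update_self]
  rfl

open Classical in
theorem residue_monomial (t : Fin k → Fin l) :
    𝒜.residue S (monomial t) =
      Matrix.det (Matrix.of fun j p => if S p ≤ 𝒜.hyp (t j) then 1 else 0) := by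
  simp only [monomial, residue_ιMulti, flagMap_single]

theorem exists_perm_le_hyp_of_residue_monomial_ne_zero {t : Fin k → Fin l}
    (h : 𝒜.residue S (monomial t) ≠ 0) :
    ∃ σ : Equiv.Perm (Fin k), ∀ p, S p ≤ 𝒜.hyp (t (σ p)) := by
  classical
  rw [residue_monomial, Matrix.det_apply] at h
  obtain ⟨σ, -, hσ⟩ := Finset.exists_ne_zero_of_sum_ne_zero h
  refine ⟨σ, fun p => ?_⟩
  by_contra hp
  exact hσ (by rw [Finset.prod_eq_zero (Finset.mem_univ p) (if_neg hp), smul_zero])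

theorem flagHom_monomial {m : ℕ} (t : Fin m → Fin l) :
    𝒜.flagHom S (monomial t) = ιMulti ℂ m fun j => 𝒜.flagMap S (Pi.single (t j) 1) :=
  map_apply_ιMulti _ _

theorem flagHom_boundary {m : ℕ} (t : Fin (m + 1) → Fin l) :
    𝒜.flagHom S (boundary t) = -∑ j : Fin (m + 1), (-1 : ℤ) ^ (j : ℕ) •
      ιMulti ℂ m (j.removeNth fun i => 𝒜.flagMap S (Pi.single (t i) 1)) := by
  rw [boundary, map_sum, ← Finset.sum_neg_distrib]
  refine Finset.sum_congr rfl fun j _ => ?_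
  rw [map_smul, flagHom_monomial, pow_succ, mul_neg_one, neg_smul, ← Int.cast_smul_eq_zsmul ℂ]
  push_cast
  rfl

variable {S}

theorem flagMap_single_eq_of_chainDepth_eq (hS : Monotone S) {i j : Fin l}
    (h : chainDepth S (𝒜.hyp i) = chainDepth S (𝒜.hyp j)) :
    𝒜.flagMap S (Pi.single i 1) = 𝒜.flagMap S (Pi.single j 1) := by
  simp only [flagMap_single, ← lt_chainDepth_iff hS, h]

variable {𝒜} in
theorem NonGeneric.flagHom_boundary_eq_zero {m : ℕ} {t : Fin (m + 1) → Fin l}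
    (h : 𝒜.NonGeneric t) (ht : Function.Injective t) (hS : Monotone S) :
    𝒜.flagHom S (boundary t) = 0 := by
  obtain ⟨a, b, hab, hdepth⟩ := h.exists_chainDepth_eq ht hS
  rw [flagHom_boundary, sum_neg_one_pow_smul_map_removeNth_eq_zero _
    (𝒜.flagMap_single_eq_of_chainDepth_eq hS hdepth) hab, neg_zero]

theorem exists_flagMap_single_eq_zero (hS : Monotone S) (hbot : ∀ p, S p ≠ ⊥) {m : ℕ}
    {t : Fin m → Fin l} (h : 𝒜.inter t = ⊥) : ∃ j, 𝒜.flagMap S (Pi.single (t j) 1) = 0 := by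
  obtain _ | k := k
  · have : Nonempty (Fin m) := by
      by_contra hm
      rw [not_nonempty_iff] at hm
      exact top_ne_bot ((iInf_of_empty fun j => 𝒜.hyp (t j)).symm.trans h)
    exact ⟨Classical.arbitrary _, Subsingleton.elim _ _⟩
  · obtain ⟨j, hj⟩ : ∃ j, ¬ S 0 ≤ 𝒜.hyp (t j) := by
      by_contra! hle
      exact hbot 0 (le_bot_iff.1 (h ▸ le_iInf hle))
    refine ⟨j, ?_⟩
    rw [flagMap_single]
    exact funext fun p => if_neg fun hp => hj ((hS (Fin.zero_le p)).trans hp)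

theorem osIdeal_le_ker_flagHom (hS : Monotone S) (hbot : ∀ p, S p ≠ ⊥) :
    𝒜.osIdeal ≤ TwoSidedIdeal.ker (𝒜.flagHom S) := by
  refine TwoSidedIdeal.span_le.2 ?_
  rintro _ (⟨m, t, ht, h, rfl⟩ | ⟨m, t, -, h, rfl⟩)
  · exact (TwoSidedIdeal.mem_ker _).2 (h.flagHom_boundary_eq_zero ht hS)
  · obtain ⟨j, hj⟩ := 𝒜.exists_flagMap_single_eq_zero hS hbot h
    exact (TwoSidedIdeal.mem_ker _).2
      ((𝒜.flagHom_monomial S t).trans ((ιMulti ℂ m).map_coord_zero j hj))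

variable {𝒜} in
theorem IsTruncatedFlag.residue_eq_of_toOS_eq (hS : 𝒜.IsTruncatedFlag S) {x y : Ext l}
    (h : 𝒜.toOS x = 𝒜.toOS y) : 𝒜.residue S x = 𝒜.residue S y := by
  have hker := 𝒜.osIdeal_le_ker_flagHom hS.strictMono.monotone (fun p => (hS.isFlat p).1)
    (𝒜.toOS_eq_toOS_iff.1 h)
  rw [← sub_eq_zero, ← map_sub, residue, LinearMap.comp_apply, AlgHom.toLinearMap_apply,
    (TwoSidedIdeal.mem_ker _).1 hker, map_zero]

theorem forall_residue_ιMulti_eq_zero_iff {r : ℕ} (M : Matrix (Fin r) (Fin l) ℂ) :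
    (∀ w : Fin k → Fin l → ℂ, (∀ j, w j ∈ Submodule.span ℂ (Set.range M.row)) →
        𝒜.residue S (ιMulti ℂ k w) = 0) ↔
      finrank ℂ (Submodule.span ℂ (Set.range fun p => 𝒜.decoration M (S p))) < k := by
  set B : Matrix (Fin k) (Fin r) ℂ := Matrix.of fun p => 𝒜.decoration M (S p)
  have hmap : (Submodule.span ℂ (Set.range M.row)).map (𝒜.flagMap S) =
      Submodule.span ℂ (Set.range B.col) := by
    rw [Submodule.map_span, ← Set.range_comp]
    exact congrArg (fun f => Submodule.span ℂ (Set.range f)) (funext (𝒜.flagMap_row S M))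
  have hrank := span_range_col_ne_top_iff B
  rw [Fintype.card_fin, ← hmap, ← forall_det_eq_zero_iff_ne_top] at hrank
  refine Iff.trans ?_ hrank
  simp only [residue_ιMulti]
  constructor
  · intro h A hA
    choose w hw hwA using hA
    obtain rfl : Matrix.of (fun j => 𝒜.flagMap S (w j)) = A := funext hwA
    exact h w hw
  · exact fun h w hw => h _ fun j => Submodule.mem_map_of_mem (hw j)

end Residue

/-! ### Monomials without broken circuits -/

/-- The chain of the intersections `H_{s p} ∩ ⋯ ∩ H_{s (k - 1)}` of the tails of a tuple. -/
def tailFlag (s : Fin k → Fin l) (p : Fin k) : Submodule ℂ (Fin (n + 1) → ℂ) :=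
  ⨅ j ≥ p, 𝒜.hyp (s j)

/-- An increasing tuple of hyperplanes with a common point contains no broken circuit, that is, no
circuit with its first hyperplane removed. This is expressed by requiring that each member of the
tuple is the first hyperplane of the arrangement containing the intersection of the tail which it
starts. -/
structure IsNBC (s : Fin k → Fin l) : Prop where
  strictMono : StrictMono s
  inter_ne_bot : 𝒜.inter s ≠ ⊥
  le_of_tailFlag_le : ∀ p i, 𝒜.tailFlag s p ≤ 𝒜.hyp i → s p ≤ i

/-- The sum of the indices of a tuple, which decreases under straightening. -/
def indexSum (t : Fin k → Fin l) : ℕ := ∑ j, (t j : ℕ)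

theorem indexSum_comp_perm (t : Fin k → Fin l) (σ : Equiv.Perm (Fin k)) :
    indexSum (t ∘ σ) = indexSum t :=
  Equiv.sum_comp σ fun j => (t j : ℕ)

section NBC

variable {𝒜} {s : Fin k → Fin l}

theorem tailFlag_le_hyp {p j : Fin k} (h : p ≤ j) : 𝒜.tailFlag s p ≤ 𝒜.hyp (s j) :=
  iInf₂_le j h

theorem inter_le_tailFlag (p : Fin k) : 𝒜.inter s ≤ 𝒜.tailFlag s p :=
  le_iInf₂ fun j _ => iInf_le _ j

theorem tailFlag_monotone : Monotone (𝒜.tailFlag s) := fun _ _ h =>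
  le_iInf₂ fun _ hj => tailFlag_le_hyp (h.trans hj)

theorem tailFlag_eq_biInf_image (s : Fin k → Fin l) (p : Fin k) :
    𝒜.tailFlag s p = ⨅ i ∈ (Finset.Ici p).image s, 𝒜.hyp i := by
  rw [Finset.iInf_finset_image]
  simp [tailFlag]

theorem tailFlag_append_natAdd_zero {p q : ℕ} (a : Fin p → Fin l) (b : Fin (q + 1) → Fin l) :
    𝒜.tailFlag (Fin.append a b) (Fin.natAdd p 0) = 𝒜.inter b := by
  refine le_antisymm (le_iInf fun j => ?_) (le_iInf₂ fun j hj => ?_)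
  · simpa using tailFlag_le_hyp (𝒜 := 𝒜) (s := Fin.append a b) (p := Fin.natAdd p 0)
      (j := Fin.natAdd p j) (by simp [Fin.le_def])
  · cases j using Fin.addCases with
    | left j => exact absurd hj (by simp [Fin.le_def])
    | right j => rw [Fin.append_right]; exact iInf_le _ j

namespace IsNBC

theorem tailFlag_le_hyp_iff (hs : 𝒜.IsNBC s) {p j : Fin k} :
    𝒜.tailFlag s p ≤ 𝒜.hyp (s j) ↔ p ≤ j :=
  ⟨fun h => hs.strictMono.le_iff_le.1 (hs.le_of_tailFlag_le p _ h), tailFlag_le_hyp⟩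

theorem chainDepth_tailFlag (hs : 𝒜.IsNBC s) (j : Fin k) :
    chainDepth (𝒜.tailFlag s) (𝒜.hyp (s j)) = j + 1 := by
  simp only [chainDepth, hs.tailFlag_le_hyp_iff, Finset.filter_ge_eq_Iic, Fin.card_Iic]

theorem finrank_tailFlag_add (hs : 𝒜.IsNBC s) (p : Fin k) :
    finrank ℂ (𝒜.tailFlag s p) + k = (p + 1) + n := by
  have hcard : ((Finset.Ici p).image s).card = k - p := by
    rw [Finset.card_image_of_injective _ hs.strictMono.injective, Fin.card_Ici]
  have hinj : Set.InjOn (fun i => chainDepth (𝒜.tailFlag s) (𝒜.hyp i))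
      ((Finset.Ici p).image s) := by
    rw [Finset.coe_image]
    rintro _ ⟨a, -, rfl⟩ _ ⟨b, -, rfl⟩ hab
    simpa [hs.chainDepth_tailFlag, Fin.val_inj, hs.strictMono.injective.eq_iff] using hab
  have h_lower := finrank_le_finrank_biInf_add_card (T := (Finset.Ici p).image s)
    fun i _ => 𝒜.finrank_space_le_finrank_hyp_add_one i
  have h_upper := finrank_biInf_add_card_le tailFlag_monotone (fun i _ => 𝒜.hyp_ne_top i) hinj
  rw [← tailFlag_eq_biInf_image, hcard, finrank_fin_fun] at h_lower h_upper
  have := p.isLt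
  omega

theorem isTruncatedFlag_tailFlag (hs : 𝒜.IsNBC s) : 𝒜.IsTruncatedFlag (𝒜.tailFlag s) where
  isFlat p := ⟨fun h => hs.inter_ne_bot (le_bot_iff.1 (h ▸ inter_le_tailFlag p)),
    _, tailFlag_eq_biInf_image s p⟩
  strictMono := tailFlag_monotone.strictMono_of_injective fun _ _ h =>
    le_antisymm (hs.tailFlag_le_hyp_iff.1 (h ▸ tailFlag_le_hyp le_rfl))
      (hs.tailFlag_le_hyp_iff.1 (h ▸ tailFlag_le_hyp le_rfl))
  finrank_add := hs.finrank_tailFlag_add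

theorem residue_tailFlag_self (hs : 𝒜.IsNBC s) :
    𝒜.residue (𝒜.tailFlag s) (monomial s) = 1 := by
  classical
  simp only [residue_monomial, hs.tailFlag_le_hyp_iff]
  rw [Matrix.det_of_isLowerTriangular]
  · simp
  · exact fun i j hij => if_neg (not_le.2 hij)

theorem eq_or_indexSum_lt_of_residue_ne_zero (hs : 𝒜.IsNBC s) {t : Fin k → Fin l}
    (ht : StrictMono t) (h : 𝒜.residue (𝒜.tailFlag s) (monomial t) ≠ 0) :
    t = s ∨ indexSum s < indexSum t := by
  obtain ⟨σ, hσ⟩ := 𝒜.exists_perm_le_hyp_of_residue_monomial_ne_zero _ h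
  have hle : s ≤ t ∘ σ := fun p => hs.le_of_tailFlag_le p _ (hσ p)
  rcases hle.eq_or_lt with heq | hlt
  · left
    rw [← ht.range_inj hs.strictMono, heq, σ.surjective.range_comp]
  · right
    obtain ⟨hle, p, hp⟩ := Pi.lt_def.1 hlt
    rw [← indexSum_comp_perm t σ]
    exact Finset.sum_lt_sum (fun q _ => hle q) ⟨p, Finset.mem_univ p, hp⟩

end IsNBC

/-- A nonzero combination has a nonzero residue along the flag of a tuple of maximal index sum
among those with nonzero coefficient. -/
theorem eq_zero_of_forall_residue_tailFlag_eq_zero {y : Ext l}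
    (hy : y ∈ Submodule.span ℂ (monomial '' {s : Fin k → Fin l | 𝒜.IsNBC s}))
    (h : ∀ s : Fin k → Fin l, 𝒜.IsNBC s → 𝒜.residue (𝒜.tailFlag s) y = 0) : y = 0 := by
  classical
  rw [Set.image_eq_range, Submodule.mem_span_range_iff_exists_fun] at hy
  obtain ⟨c, rfl⟩ := hy
  suffices hc : c = 0 by simp [hc]
  by_contra hc
  obtain ⟨s₀, hs₀⟩ := Function.ne_iff.1 hc
  obtain ⟨s, hs, hmax⟩ := Finset.exists_max_image {s | c s ≠ 0}
    (fun s => indexSum s.1) ⟨s₀, by simpa using hs₀⟩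
  have hother : ∀ t ≠ s, 𝒜.residue (𝒜.tailFlag s.1) (c t • monomial t.1) = 0 := by
    intro t hts
    by_contra hne
    rw [map_smul, smul_eq_mul, mul_eq_zero, not_or] at hne
    rcases s.2.eq_or_indexSum_lt_of_residue_ne_zero t.2.strictMono hne.2 with heq | hlt
    · exact hts (Subtype.ext heq)
    · exact (hmax t (by simpa using hne.1)).not_gt hlt
  have hcoeff := h s.1 s.2
  rw [map_sum, Fintype.sum_eq_single s hother, map_smul, s.2.residue_tailFlag_self, smul_eq_mul,
    mul_one] at hcoeff
  exact (Finset.mem_filter.1 hs).2 hcoeff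

end NBC

/-! ### Straightening -/

theorem indexSum_append {p q : ℕ} (a : Fin p → Fin l) (b : Fin q → Fin l) :
    indexSum (Fin.append a b) = indexSum a + indexSum b := by
  simp [indexSum, Fin.sum_univ_add]

theorem indexSum_cons_comp_succAbove_lt {i : Fin l} {b : Fin k → Fin l} {j : Fin k}
    (h : i < b j) :
    indexSum ((Fin.cons i b : Fin (k + 1) → Fin l) ∘ j.succ.succAbove) < indexSum b := by
  have hsum := Fin.sum_univ_succAbove
    (fun j => ((Fin.cons i b : Fin (k + 1) → Fin l) j : ℕ)) j.succ
  rw [Fin.sum_univ_succ] at hsum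
  simp only [Fin.cons_zero, Fin.cons_succ] at hsum
  have : (i : ℕ) < b j := h
  simp only [indexSum, Function.comp_apply]
  omega

/-- The span, in the Orlik-Solomon algebra, of the monomials indexed by a set of tuples. -/
noncomputable def monomialSpan (P : Set (Fin k → Fin l)) : Submodule ℂ 𝒜.OS :=
  (Submodule.span ℂ (monomial '' P)).map 𝒜.toOS.toLinearMap

variable {𝒜}

theorem toOS_monomial_mem_monomialSpan {P : Set (Fin k → Fin l)} {t : Fin k → Fin l}
    (ht : t ∈ P) : 𝒜.toOS (monomial t) ∈ 𝒜.monomialSpan P :=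
  Submodule.mem_map_of_mem (Submodule.subset_span ⟨t, ht, rfl⟩)

theorem monomialSpan_le {P : Set (Fin k → Fin l)} {W : Submodule ℂ 𝒜.OS} :
    𝒜.monomialSpan P ≤ W ↔ ∀ t ∈ P, 𝒜.toOS (monomial t) ∈ W := by
  rw [monomialSpan, Submodule.map_span_le, Set.forall_mem_image]
  rfl

theorem NonGeneric.toOS_monomial_append_tail {p m : ℕ} (a : Fin p → Fin l)
    {c : Fin (m + 1) → Fin l} (h : 𝒜.NonGeneric c) (hc : Function.Injective c) :
    𝒜.toOS (monomial (Fin.append a (Fin.tail c))) =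
      ∑ j : Fin m, (-1 : ℂ) ^ (j : ℕ) •
        𝒜.toOS (monomial (Fin.append a (c ∘ j.succ.succAbove))) := by
  have hmem : boundary c ∈ 𝒜.osIdeal := TwoSidedIdeal.subset_span (Or.inl ⟨m, c, hc, h, rfl⟩)
  have hzero := 𝒜.toOS_eq_zero_iff.2 (𝒜.osIdeal.mul_mem_left (monomial a) _ hmem)
  rw [monomial_mul_boundary, map_sum, Fin.sum_univ_succ] at hzero
  simp only [map_smul, Fin.val_zero, zero_add, neg_smul, one_smul, Fin.succAbove_zero,
    Fin.val_succ, pow_zero, pow_succ, mul_neg, mul_one, neg_neg] at hzero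
  exact neg_add_eq_zero.1 hzero

theorem toOS_monomial_append_mem_monomialSpan {p q : ℕ} (a : Fin p → Fin l) {b : Fin q → Fin l}
    {i : Fin l} (hb : Function.Injective b) (hi : ∀ j, i < b j) (hbot : 𝒜.inter b ≠ ⊥)
    (hle : 𝒜.inter b ≤ 𝒜.hyp i) :
    𝒜.toOS (monomial (Fin.append a b)) ∈
      𝒜.monomialSpan {t : Fin (p + q) → Fin l | indexSum t < indexSum (Fin.append a b)} := by
  have hinj : Function.Injective (Fin.cons i b : Fin (q + 1) → Fin l) :=
    Fin.cons_injective_iff.2 ⟨fun ⟨j, hj⟩ => (hi j).ne' hj, hb⟩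
  have hrel := (𝒜.nonGeneric_cons hbot hle).toOS_monomial_append_tail a hinj
  rw [Fin.tail_cons] at hrel
  rw [hrel]
  refine Submodule.sum_mem _ fun j _ =>
    Submodule.smul_mem _ _ (toOS_monomial_mem_monomialSpan ?_)
  rw [Set.mem_ofPred_eq, indexSum_append, indexSum_append]
  exact Nat.add_lt_add_left (indexSum_cons_comp_succAbove_lt (hi j)) _

theorem toOS_monomial_mem_monomialSpan_of_not_isNBC {s : Fin k → Fin l} (hs : StrictMono s)
    (hbot : 𝒜.inter s ≠ ⊥) (h : ¬ 𝒜.IsNBC s) :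
    𝒜.toOS (monomial s) ∈ 𝒜.monomialSpan {t : Fin k → Fin l | indexSum t < indexSum s} := by
  obtain ⟨⟨p, hp⟩, i, hle, hi⟩ : ∃ p i, 𝒜.tailFlag s p ≤ 𝒜.hyp i ∧ i < s p := by
    by_contra! hne
    exact h ⟨hs, hbot, hne⟩
  obtain ⟨q, rfl⟩ : ∃ q, k = p + (q + 1) := ⟨k - p - 1, by omega⟩
  obtain ⟨a, b, rfl⟩ : ∃ (a : Fin p → Fin l) (b : Fin (q + 1) → Fin l), s = Fin.append a b :=
    ⟨_, _, Fin.append_castAdd_natAdd.symm⟩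
  change 𝒜.tailFlag _ (Fin.natAdd p 0) ≤ _ at hle
  change i < Fin.append a b (Fin.natAdd p 0) at hi
  have hbot_tail := ne_bot_of_le_ne_bot hbot (inter_le_tailFlag (Fin.natAdd p 0))
  have hb : StrictMono b := fun x y hxy => by
    simpa using hs (Fin.strictMono_natAdd p hxy)
  rw [tailFlag_append_natAdd_zero] at hle hbot_tail
  rw [Fin.append_right] at hi
  exact toOS_monomial_append_mem_monomialSpan a hb.injective
    (fun j => hi.trans_le (hb.monotone (Fin.zero_le j))) hbot_tail hle

theorem toOS_monomial_comp_perm_mem_iff {W : Submodule ℂ 𝒜.OS} (t : Fin k → Fin l)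
    (σ : Equiv.Perm (Fin k)) :
    𝒜.toOS (monomial (t ∘ σ)) ∈ W ↔ 𝒜.toOS (monomial t) ∈ W := by
  rw [monomial_comp_perm]
  rcases Int.units_eq_one_or (Equiv.Perm.sign σ) with hσ | hσ <;> simp [hσ]

theorem toOS_monomial_mem_monomialSpan_isNBC (t : Fin k → Fin l) :
    𝒜.toOS (monomial t) ∈ 𝒜.monomialSpan {s : Fin k → Fin l | 𝒜.IsNBC s} := by
  induction hN : indexSum t using Nat.strong_induction_on generalizing t with
  | _ N ih =>
    subst hN
    by_cases hinj : Function.Injective t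
    swap
    · rw [monomial_eq_zero_of_not_injective hinj, map_zero]
      exact Submodule.zero_mem _
    have hs : StrictMono (t ∘ Tuple.sort t) :=
      (Tuple.monotone_sort t).strictMono_of_injective (hinj.comp (Tuple.sort t).injective)
    rw [← toOS_monomial_comp_perm_mem_iff t (Tuple.sort t)]
    by_cases hbot : 𝒜.inter (t ∘ Tuple.sort t) = ⊥
    · rw [𝒜.toOS_eq_zero_iff.2
        (TwoSidedIdeal.subset_span (Or.inr ⟨_, _, hs.injective, hbot, rfl⟩))]
      exact Submodule.zero_mem _
    by_cases hnbc : 𝒜.IsNBC (t ∘ Tuple.sort t)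
    · exact toOS_monomial_mem_monomialSpan hnbc
    · refine monomialSpan_le.2 (fun u hu => ih _ ?_ u rfl)
        (toOS_monomial_mem_monomialSpan_of_not_isNBC hs hbot hnbc)
      rwa [← indexSum_comp_perm t (Tuple.sort t)]

variable (𝒜) in
theorem map_toOS_exteriorPower_le_monomialSpan_isNBC :
    (⋀[ℂ]^k (Fin l → ℂ)).map 𝒜.toOS.toLinearMap ≤
      𝒜.monomialSpan {s : Fin k → Fin l | 𝒜.IsNBC s} := by
  rw [← span_range_monomial, Submodule.map_span_le, Set.forall_mem_range]
  exact toOS_monomial_mem_monomialSpan_isNBC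

variable (𝒜) in
theorem toOS_eq_zero_iff_forall_residue_eq_zero {x : Ext l} (hx : x ∈ ⋀[ℂ]^k (Fin l → ℂ)) :
    𝒜.toOS x = 0 ↔ ∀ S : Fin k → Submodule ℂ (Fin (n + 1) → ℂ),
      𝒜.IsTruncatedFlag S → 𝒜.residue S x = 0 := by
  constructor
  · intro h S hS
    rw [hS.residue_eq_of_toOS_eq (h.trans (map_zero 𝒜.toOS).symm), map_zero]
  · intro h
    obtain ⟨y, hy, hyx⟩ :=
      𝒜.map_toOS_exteriorPower_le_monomialSpan_isNBC (Submodule.mem_map_of_mem hx)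
    have hy_zero : y = 0 := eq_zero_of_forall_residue_tailFlag_eq_zero hy fun s hs =>
      (hs.isTruncatedFlag_tailFlag.residue_eq_of_toOS_eq hyx).trans
        (h _ hs.isTruncatedFlag_tailFlag)
    rw [← AlgHom.toLinearMap_apply, ← hyx, hy_zero, map_zero]

end ProjArrangement

theorem mainTheorem2 {n l : ℕ} (𝒜 : ProjArrangement n l)
    (V : Submodule ℂ 𝒜.OS) (hV : V ≤ 𝒜.degreeOne)
    {r : ℕ} (M : Matrix (Fin r) (Fin l) ℂ)
    (hM : Submodule.span ℂ (Set.range fun j : Fin r => ∑ i, M j i • 𝒜.gen i) = V)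
    (k : ℕ) :
    𝒜.IsIsotropic k V ↔
      ∀ S : Fin k → Submodule ℂ (Fin (n + 1) → ℂ), 𝒜.IsTruncatedFlag S →
        Module.finrank ℂ
          (Submodule.span ℂ (Set.range fun i : Fin k => 𝒜.decoration M (S i))) < k := by
  have hrows : V = (Submodule.span ℂ (Set.range M.row)).map
      (𝒜.toOS.toLinearMap ∘ₗ ExteriorAlgebra.ι ℂ) := by
    rw [← hM, Submodule.map_span, ← Set.range_comp]
    exact congrArg (fun f => Submodule.span ℂ (Set.range f))
      (funext fun j => (𝒜.toOS_ι (M.row j)).symm)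
  have hdetect (w : Fin k → Fin l → ℂ) :=
    𝒜.toOS_eq_zero_iff_forall_residue_eq_zero (ExteriorAlgebra.ιMulti_range ℂ k ⟨w, rfl⟩)
  simp only [hrows, 𝒜.isIsotropic_map_iff, hdetect, ← 𝒜.forall_residue_ιMulti_eq_zero_iff]
  exact ⟨fun h S hS w hw => h w hw S hS, fun h w hw S hS => h S hS w hw⟩
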